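/- A separable field extension $F/k$ of degree $n$ is called \emph{generic} if the Galois group $\mathrm{Gal}(L/k)$ of the normal closure $L$ of $F$ over $k$ is isomorphic to the symmetric group $S_n$. Its norm torus $T_{F/k}$ is the $k$-variety $\ker[N\colon R_{F/k}(\mathbb{G}_m)\to\mathbb{G}_{m,k}]$, where $R_{F/k}$ denotes restriction of scalars and $N$ the norm map. A $k$-variety is \emph{rational} if it is birational over $k$ to some affine space $\mathbb{A}^m_k$, and a $k$-variety $X$ is \emph{stably rational} over $k$ if there is a rational $k$-variety $Y$ such that $X\times_k Y$ is rational. Let $n=rs$ with integers $r,s>1$, let $F/k$ be a generic extension of degree $n$, and let $L$ be the normal closure of $F$ over $k$. If $T_{F/k}$ is stably rational over $k$, then there are intermediate fields $k\subseteq E\subseteq K\subseteq L$ such that $K/E$ is a generic extension of degree $r$ and $T_{K/E}$ is stably rational over $E$. -/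

import Mathlib

open CategoryTheory CategoryTheory.Limits AlgebraicGeometry
open scoped TensorProduct

universe u

/-- A finite separable field extension `F / k` of degree `n` is generic if the Galois group over
`k` of the normal closure of `F` over `k` is isomorphic to the symmetric group on `n` letters. -/
structure IsGenericExtension (k F : Type u) [Field k] [Field F] [Algebra k F] (n : ℕ) :
    Prop where
  finiteDimensional : FiniteDimensional k F
  isSeparable : Algebra.IsSeparable k F
  finrank_eq : Module.finrank k F = n
  gal_equiv : Nonempty
    (Gal(IntermediateField.normalClosure k F (AlgebraicClosure F)/k) ≃* Equiv.Perm (Fin n))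

noncomputable section

/-! ### The norm torus -/

section NormTorus

variable (k F : Type u) [Field k] [Field F] [Algebra k F] [FiniteDimensional k F]

/-- The generic element `∑ i, X i • b i` of `F`, where `b` is a basis of `F` over `k`, as an
element of `k[X i] ⊗ F`. -/
def genericElement : MvPolynomial (Fin (Module.finrank k F)) k ⊗[k] F :=
  ∑ i, MvPolynomial.X i ⊗ₜ[k] Module.finBasis k F i

/-- The norm form of `F / k`: the norm of the generic element. -/
def normForm : MvPolynomial (Fin (Module.finrank k F)) k :=
  Algebra.norm (MvPolynomial (Fin (Module.finrank k F)) k) (genericElement k F)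

/-- The coordinate ring `k[X i] / (N - 1)` of the norm torus, with `N` the norm form. -/
abbrev NormTorusRing : Type u :=
  MvPolynomial (Fin (Module.finrank k F)) k ⧸ Ideal.span {normForm k F - 1}

/-- The norm torus of `F / k`, i.e. the kernel of the norm map from the Weil restriction of the
multiplicative group of `F` to the multiplicative group of `k`, as a scheme. -/
abbrev normTorus : Scheme.{u} := Spec (CommRingCat.of (NormTorusRing k F))

/-- The structure morphism of the norm torus of `F / k`. -/
abbrev normTorusHom : normTorus k F ⟶ Spec (CommRingCat.of k) :=
  Spec.map (CommRingCat.ofHom (algebraMap k (NormTorusRing k F)))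

end NormTorus

/-! ### Rational and stably rational varieties -/

/-- A variety over a field: an integral scheme, separated and of finite type over the field. -/
structure IsVariety {k : Type u} [Field k] {X : Scheme.{u}}
    (sX : X ⟶ Spec (CommRingCat.of k)) : Prop where
  isIntegral : IsIntegral X
  isSeparated : IsSeparated sX
  locallyOfFiniteType : LocallyOfFiniteType sX
  quasiCompact : QuasiCompact sX

/-- `X` is rational over `k` if it is birational over `k` to an affine space of some finite
dimension. -/
def IsRational {k : Type u} [Field k] {X : Scheme.{u}}
    (sX : X ⟶ Spec (CommRingCat.of k)) : Prop :=
  ∃ n : ℕ, Scheme.BirationalOver sX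
    (𝔸(ULift.{u} (Fin n); Spec (CommRingCat.of k)) ↘ Spec (CommRingCat.of k))

/-- `X` is stably rational over `k` if there is a rational variety `Y` over `k` such that the
product of `X` and `Y` over `k` is rational over `k`. -/
def IsStablyRational {k : Type u} [Field k] {X : Scheme.{u}}
    (sX : X ⟶ Spec (CommRingCat.of k)) : Prop :=
  ∃ (Y : Scheme.{u}) (sY : Y ⟶ Spec (CommRingCat.of k)),
    IsVariety sY ∧ IsRational sY ∧ IsRational (pullback.fst sX sY ≫ sX)

end

/-!
The norm torus `T` of `F / k` is treated through its points: for a `k`-algebra `R`, a map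
`k[T] → R` is an element of norm one in `R ⊗ F`. Stable rationality of `T` means that `T × 𝔸^d` is
birational to an affine space, and this is preserved by extending the base field to any `E`. No
lattices or cohomology are needed; everything comes from choosing `E` so that `F` splits over `E`
into equal blocks.

The Galois group of the normal closure `L` acts faithfully on the `r * s` embeddings of `F` in `L`
and has order `(r * s)!`, so it is the full symmetric group on them. Arrange the embeddings in an
`s × r` array, let `S_r` permute the columns, and let `E` be its fixed field and `K` the fixed field
of the stabilizer of one column (`exists_diagonal_perm`, `letterField`). Then `K / E` is generic of
degree `r` (`isGenericExtension_letterField`), and each row of the array gives an embedding of `F`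
in `K`; together these identify `E ⊗ F` with `K ^ s` (`exists_tensorProduct_equiv`), the injectivity
being Dedekind's independence of characters.

Consequently the points of `T_E` with values in an `E`-algebra `R` are the tuples `(u_0, …,
u_{s-1})` of units of `R ⊗ K` with `∏ N(u_i) = 1`. The coordinate change `(u_i) ↦ (∏ u_i, u_1,
…, u_{s-1})` identifies it with the product of the norm torus of `K / E` and of `s - 1` copies
of the Weil restriction of the multiplicative group, and the latter is a dense open subscheme of
an affine space (`isLocalization_productRingHom`). Hence the norm torus of `K / E`, multiplied
by an affine space, is birational to an affine space (`IsStablyRational.of_splitting`).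
-/

/-! ### Birational maps and base change -/

/-- Universal openness is what makes density survive: preimages of dense sets under open maps are
dense. -/
lemma AlgebraicGeometry.IsDominant.of_isPullback {W X Y Z : Scheme.{u}}
    {p : W ⟶ X} {q : W ⟶ Y} {f : X ⟶ Z} {g : Y ⟶ Z} (h : IsPullback p q f g)
    [IsDominant f] [UniversallyOpen g] : IsDominant q := by
  rw [← h.isoPullback_hom_snd]
  have : IsDominant (pullback.snd f g) := by
    refine ⟨?_⟩
    rw [DenseRange, Scheme.Pullback.range_snd]
    exact f.denseRange.preimage g.isOpenMap
  infer_instance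

lemma AlgebraicGeometry.Scheme.BirationalOver.comp {S T X Y : Scheme.{u}}
    {sX : X ⟶ S} {sY : Y ⟶ S}
    (h : Scheme.BirationalOver sX sY) (t : S ⟶ T) :
    Scheme.BirationalOver (sX ≫ t) (sY ≫ t) := by
  obtain ⟨f, hf⟩ := h
  refine ⟨f, ?_⟩
  have := congr($hf ≫ t)
  simpa [Scheme.PartialIso.IsOver] using this

/-- The base change of a dominant open immersion is birational. -/
lemma AlgebraicGeometry.Scheme.birationalOver_snd_of_isPullback {S T U X X' : Scheme.{u}}
    {sX : X ⟶ S} {sU : U ⟶ S} {t : T ⟶ S} [UniversallyOpen t] {pX : X' ⟶ X} {sX' : X' ⟶ T}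
    (hX : IsPullback pX sX' sX t) (i : U ⟶ X) [IsOpenImmersion i] [IsDominant i]
    (hi : i ≫ sX = sU) : Scheme.BirationalOver (pullback.snd sU t) sX' := by
  let j : pullback sU t ⟶ X' :=
    hX.lift (pullback.fst sU t ≫ i) (pullback.snd sU t)
      (by rw [Category.assoc, hi, pullback.condition])
  have hj : IsPullback (pullback.fst sU t) j i pX := by
    refine .flip (.of_right ?_ (by simp [j]) hX.flip)
    have := (IsPullback.of_hasPullback sU t).flip
    simpa [j, hi] using this
  have : UniversallyOpen pX := MorphismProperty.of_isPullback hX.flip ‹_›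
  have : IsOpenImmersion j := MorphismProperty.of_isPullback hj ‹_›
  have : IsDominant j := .of_isPullback hj
  exact Scheme.Hom.birationalOver j _ _ (by simp [j])

/-- Birational equivalence over `S` is preserved by universally open base change. -/
lemma AlgebraicGeometry.Scheme.BirationalOver.of_isPullback {S T X Y X' Y' : Scheme.{u}}
    {sX : X ⟶ S} {sY : Y ⟶ S} {t : T ⟶ S} [UniversallyOpen t]
    {pX : X' ⟶ X} {sX' : X' ⟶ T} {pY : Y' ⟶ Y} {sY' : Y' ⟶ T}
    (hX : IsPullback pX sX' sX t) (hY : IsPullback pY sY' sY t)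
    (h : Scheme.BirationalOver sX sY) : Scheme.BirationalOver sX' sY' := by
  obtain ⟨f, hf⟩ := h
  have := Opens.isDominant_ι f.dense_source
  have := Opens.isDominant_ι f.dense_target
  exact (Scheme.birationalOver_snd_of_isPullback hX f.source.ι rfl).symm.trans
    (Scheme.birationalOver_snd_of_isPullback hY (f.iso.hom ≫ f.target.ι)
      (by rw [Category.assoc, hf]))

lemma AlgebraicGeometry.Scheme.BirationalOver.of_iso {S X Y : Scheme.{u}}
    {sX : X ⟶ S} {sY : Y ⟶ S}
    (e : X ≅ Y) (he : e.hom ≫ sY = sX) : Scheme.BirationalOver sX sY :=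
  Scheme.Hom.birationalOver e.hom _ _ he

/-- An injective localization map `R → S` at one element makes `Spec S` a dense open subscheme of
`Spec R`. -/
lemma AlgebraicGeometry.Scheme.birationalOver_Spec_of_away {A R S : Type u} [CommRing A]
    [CommRing R] [CommRing S]
    [Algebra A R] [Algebra A S] [Algebra R S] [IsScalarTower A R S] (g : R)
    [IsLocalization.Away g S] (hg : Function.Injective (algebraMap R S)) :
    Scheme.BirationalOver (Spec.map (CommRingCat.ofHom (algebraMap A S)))
      (Spec.map (CommRingCat.ofHom (algebraMap A R))) := by
  have := IsOpenImmersion.of_isLocalization (S := S) g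
  have : IsDominant (Spec.map (CommRingCat.ofHom (algebraMap R S))) := by
    refine ⟨(PrimeSpectrum.denseRange_comap_iff_ker_le_nilRadical _).2 ?_⟩
    have : RingHom.ker (algebraMap R S) = ⊥ := (RingHom.injective_iff_ker_eq_bot _).1 hg
    simp [this]
  refine Scheme.Hom.birationalOver (Spec.map (CommRingCat.ofHom (algebraMap R S))) _ _ ?_
  rw [← Spec.map_comp, ← CommRingCat.ofHom_comp, ← IsScalarTower.algebraMap_eq]

lemma AlgebraicGeometry.Scheme.birationalOver_Spec_of_algEquiv {A R S : Type u} [CommRing A]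
    [CommRing R] [CommRing S] [Algebra A R] [Algebra A S] (e : R ≃ₐ[A] S) :
    Scheme.BirationalOver (Spec.map (CommRingCat.ofHom (algebraMap A S)))
      (Spec.map (CommRingCat.ofHom (algebraMap A R))) := by
  refine .of_iso (Scheme.Spec.mapIso e.toRingEquiv.toCommRingCatIso.op) ?_
  simp only [Functor.mapIso_hom, Iso.op_hom, Scheme.Spec_map, Quiver.Hom.unop_op, ← Spec.map_comp]
  congr 1
  ext x
  simp

/-! ### Affine spaces -/

lemma AlgebraicGeometry.Scheme.birationalOver_affineSpace_Spec (n : Type u) (R : Type u)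
    [CommRing R] :
    Scheme.BirationalOver (𝔸(n; Spec (.of R)) ↘ Spec (.of R))
      (Spec.map (CommRingCat.ofHom (algebraMap R (MvPolynomial n R)))) :=
  .symm <| .of_iso (AffineSpace.SpecIso n (.of R)).symm (AffineSpace.SpecIso_inv_over (.of R))

lemma AlgebraicGeometry.Scheme.birationalOver_affineSpace_of_equiv {m n : Type u} (e : m ≃ n)
    (R : Type u) [CommRing R] :
    Scheme.BirationalOver (𝔸(m; Spec (.of R)) ↘ Spec (.of R))
      (𝔸(n; Spec (.of R)) ↘ Spec (.of R)) :=
  (birationalOver_affineSpace_Spec m R).trans <|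
    (birationalOver_Spec_of_algEquiv (MvPolynomial.renameEquiv R e.symm)).trans
    (birationalOver_affineSpace_Spec n R).symm

lemma AlgebraicGeometry.Scheme.birationalOver_affineSpace_sum (m n : Type u)
    (R : Type u) [CommRing R] :
    Scheme.BirationalOver
      ((𝔸(m; Spec (.of (MvPolynomial n R))) ↘ Spec (.of (MvPolynomial n R))) ≫
        Spec.map (CommRingCat.ofHom (algebraMap R (MvPolynomial n R))))
      (𝔸(m ⊕ n; Spec (.of R)) ↘ Spec (.of R)) := by
  refine ((birationalOver_affineSpace_Spec m (MvPolynomial n R)).comp _).trans <|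
    .trans ?_ (birationalOver_affineSpace_Spec (m ⊕ n) R).symm
  rw [← Spec.map_comp, ← CommRingCat.ofHom_comp, ← IsScalarTower.algebraMap_eq]
  exact birationalOver_Spec_of_algEquiv (MvPolynomial.sumAlgEquiv R m n)

lemma isVariety_affineSpace (k : Type u) [Field k] (n : Type u) [Finite n] :
    IsVariety (𝔸(n; Spec (CommRingCat.of k)) ↘ Spec (CommRingCat.of k)) where
  isIntegral := inferInstance
  isSeparated := inferInstance
  locallyOfFiniteType := inferInstance
  quasiCompact := inferInstance

/-! ### Stable rationality and base change -/

/-- The rational factor `Y` may be replaced by an affine space. -/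
lemma IsStablyRational.exists_affineSpace {k : Type u} [Field k] {X : Scheme.{u}}
    {sX : X ⟶ Spec (CommRingCat.of k)} (h : IsStablyRational sX) :
    ∃ d : ℕ, IsRational (𝔸(ULift.{u} (Fin d); X) ↘ X ≫ sX) := by
  obtain ⟨Y, sY, -, ⟨d, hd⟩, m, hm⟩ := h
  refine ⟨d, m, .trans (.comp ?_ sX) hm⟩
  exact .symm <| hd.of_isPullback (t := sX) (IsPullback.of_hasPullback sX sY).flip
    (AffineSpace.isPullback_map sX)

lemma IsStablyRational.of_affineSpace {k : Type u} [Field k] {X : Scheme.{u}}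
    {sX : X ⟶ Spec (CommRingCat.of k)} {n : Type u} [Finite n]
    (h : IsRational (𝔸(n; X) ↘ X ≫ sX)) : IsStablyRational sX := by
  refine ⟨_, 𝔸(n; Spec (CommRingCat.of k)) ↘ Spec (CommRingCat.of k), isVariety_affineSpace k n,
    ⟨Nat.card n, Scheme.birationalOver_affineSpace_of_equiv
      ((Finite.equivFin n).trans Equiv.ulift.symm) k⟩, ?_⟩
  obtain ⟨m, hm⟩ := h
  refine ⟨m, .trans (.comp ?_ sX) hm⟩
  exact .of_isPullback (sX := 𝔸(n; Spec (CommRingCat.of k)) ↘ Spec (CommRingCat.of k)) (t := sX)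
    (IsPullback.of_hasPullback _ _).flip (AffineSpace.isPullback_map sX) (.refl _)

lemma IsRational.of_isPullback {k E : Type u} [Field k] [Field E] {X X' : Scheme.{u}}
    {sX : X ⟶ Spec (CommRingCat.of k)} {sX' : X' ⟶ Spec (CommRingCat.of E)}
    {p : X' ⟶ X} {t : Spec (CommRingCat.of E) ⟶ Spec (CommRingCat.of k)}
    (h : IsPullback p sX' sX t) (hX : IsRational sX) : IsRational sX' := by
  obtain ⟨m, hm⟩ := hX
  exact ⟨m, hm.of_isPullback h (AffineSpace.isPullback_map t)⟩

/-- If, after extending scalars from `k` to `E`, `Spec A` becomes an open dense subscheme of the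
product of `Spec B` with an affine space, then stable rationality passes from `A` to `B`. -/
lemma IsStablyRational.of_away_tensorProduct {k E A B C P : Type u} [Field k] [Field E]
    [Algebra k E] [CommRing A] [CommRing B] [CommRing C] [CommRing P] [Algebra k A] [Algebra E B]
    [Algebra E C] [Algebra E P] [Algebra P C] [IsScalarTower E P C] {n : Type u} [Finite n]
    (h : IsStablyRational (Spec.map (CommRingCat.ofHom (algebraMap k A))))
    (eP : P ≃ₐ[E] MvPolynomial n B) (eC : C ≃ₐ[E] E ⊗[k] A) (g : P) [IsLocalization.Away g C]
    (hg : Function.Injective (algebraMap P C)) :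
    IsStablyRational (Spec.map (CommRingCat.ofHom (algebraMap E B))) := by
  obtain ⟨d, hd⟩ := h.exists_affineSpace
  -- the base change of `Spec A` to `E`
  have hA : IsPullback (Spec.map (CommRingCat.ofHom
        (Algebra.TensorProduct.includeRight (R := k) (A := E) (B := A)).toRingHom))
      (Spec.map (CommRingCat.ofHom (algebraMap E (E ⊗[k] A))))
      (Spec.map (CommRingCat.ofHom (algebraMap k A)))
      (Spec.map (CommRingCat.ofHom (algebraMap k E))) :=
    ((CommRingCat.isPushout_tensorProduct k E A).op.map Scheme.Spec)
  obtain ⟨m, hm⟩ : IsRational _ := hd.of_isPullback ((AffineSpace.isPullback_map _).paste_vert hA)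
  -- the dense open immersion into `Spec B[n]`, times the `d`-dimensional affine space
  have hPC := (Scheme.birationalOver_Spec_of_algEquiv eC).trans <|
    (Scheme.birationalOver_Spec_of_away (A := E) g hg).trans
    (Scheme.birationalOver_Spec_of_algEquiv eP.symm)
  have hP := (hPC.of_isPullback
    (AffineSpace.isPullback_map (n := ULift.{u} (Fin d)) _).flip
    (AffineSpace.isPullback_map (n := ULift.{u} (Fin d)) _).flip).comp
    (𝔸(ULift.{u} (Fin d); Spec (CommRingCat.of E)) ↘ Spec (CommRingCat.of E))
  rw [AffineSpace.map_over, AffineSpace.map_over] at hP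
  have hB := (Scheme.birationalOver_affineSpace_sum (ULift.{u} (Fin d)) n B).comp
    (Spec.map (CommRingCat.ofHom (algebraMap E B)))
  rw [Category.assoc, ← Spec.map_comp, ← CommRingCat.ofHom_comp,
    ← IsScalarTower.algebraMap_eq] at hB
  exact .of_affineSpace ⟨m, hB.symm.trans (hP.symm.trans hm)⟩

/-! ### Norms of algebras -/

section Norm

lemma Module.Basis.baseChange_repr_map {k B R R' ι : Type*} [CommRing k] [CommRing B] [Algebra k B]
    [CommRing R] [Algebra k R] [CommRing R'] [Algebra k R'] (b : Module.Basis ι k B)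
    (f : R →ₐ[k] R') (u : R ⊗[k] B) (i : ι) :
    (b.baseChange R').repr (Algebra.TensorProduct.map f (AlgHom.id k B) u) i =
      f ((b.baseChange R).repr u i) := by
  induction u with
  | zero => simp
  | tmul x y => simp [Algebra.smul_def, Algebra.commutes]
  | add x y hx hy => simp [hx, hy]

/-- The norm of a free algebra is compatible with change of scalars. -/
lemma Algebra.norm_tensorProduct_map {k B R R' : Type*} [CommRing k] [CommRing B] [Algebra k B]
    [Module.Free k B] [Module.Finite k B]
    [CommRing R] [Algebra k R] [CommRing R'] [Algebra k R'] (f : R →ₐ[k] R') (u : R ⊗[k] B) :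
    Algebra.norm R' (Algebra.TensorProduct.map f (AlgHom.id k B) u) = f (Algebra.norm R u) := by
  classical
  let b := Module.Free.chooseBasis k B
  rw [Algebra.norm_eq_matrix_det (b.baseChange R'), Algebra.norm_eq_matrix_det (b.baseChange R),
    AlgHom.map_det]
  congr 1
  ext i j
  rw [AlgHom.mapMatrix_apply, Matrix.map_apply, Algebra.leftMulMatrix_eq_repr_mul,
    Algebra.leftMulMatrix_eq_repr_mul, ← Module.Basis.baseChange_repr_map,
    map_mul (Algebra.TensorProduct.map f (AlgHom.id k B))]
  simp

lemma Algebra.norm_pi {R A I : Type*} [CommRing R] [CommRing A] [Algebra R A] [Module.Free R A]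
    [Module.Finite R A] [Fintype I] (x : I → A) :
    Algebra.norm R x = ∏ i, Algebra.norm R (x i) := by
  simp only [Algebra.norm_apply, ← LinearMap.det_pi]
  rfl

lemma Algebra.isUnit_of_isUnit_norm {R A : Type*} [CommRing R] [CommRing A] [Algebra R A]
    [Module.Free R A] [Module.Finite R A] {x : A} (hx : IsUnit (Algebra.norm R x)) : IsUnit x := by
  rw [Algebra.norm_apply, ← LinearMap.isUnit_iff_isUnit_det, Module.End.isUnit_iff] at hx
  obtain ⟨y, hy⟩ := hx.2 1
  exact .of_mul_eq_one y hy

end Norm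

/-! ### Points of the norm torus -/

section Points

variable {k : Type u} (F : Type u) [Field k] [Field F] [Algebra k F] [FiniteDimensional k F]
variable {R R' : Type u} [CommRing R] [Algebra k R] [CommRing R'] [Algebra k R']

/-- The element of `R ⊗ F` with given coordinates over `R` in the basis of `F` over `k` that enters
the definition of the norm form. -/
noncomputable def ofCoords : (Fin (Module.finrank k F) → R) ≃ₗ[R] R ⊗[k] F :=
  ((Module.finBasis k F).baseChange R).equivFun.symm

lemma ofCoords_apply (v : Fin (Module.finrank k F) → R) :
    ofCoords F v = ∑ i, v i ⊗ₜ[k] Module.finBasis k F i := by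
  simp [ofCoords, Module.Basis.equivFun_symm_apply, TensorProduct.smul_tmul']

lemma map_ofCoords (f : R →ₐ[k] R') (v : Fin (Module.finrank k F) → R) :
    Algebra.TensorProduct.map f (AlgHom.id k F) (ofCoords F v) = ofCoords F (fun i ↦ f (v i)) := by
  simp [ofCoords_apply]

lemma genericElement_eq : genericElement k F = ofCoords F MvPolynomial.X := by
  rw [ofCoords_apply, genericElement]

lemma norm_ofCoords (v : Fin (Module.finrank k F) → R) :
    Algebra.norm R (ofCoords F v) = MvPolynomial.aeval v (normForm k F) := by
  rw [normForm, ← Algebra.norm_tensorProduct_map, genericElement_eq, map_ofCoords]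
  simp

lemma normForm_aeval_ofCoords_symm (u : R ⊗[k] F) :
    MvPolynomial.aeval ((ofCoords F).symm u) (normForm k F) = Algebra.norm R u := by
  rw [← norm_ofCoords, LinearEquiv.apply_symm_apply]

variable (k) in
/-- The tautological point of the norm torus. -/
noncomputable def normTorusPoint : NormTorusRing k F ⊗[k] F :=
  ofCoords F fun i ↦ Ideal.Quotient.mk _ (MvPolynomial.X i)

variable (k) in
lemma norm_normTorusPoint : Algebra.norm (NormTorusRing k F) (normTorusPoint k F) = 1 := by
  have h : normTorusPoint k F = Algebra.TensorProduct.map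
      (Ideal.Quotient.mkₐ k (Ideal.span {normForm k F - 1})) (AlgHom.id k F)
      (genericElement k F) := by
    rw [genericElement_eq, map_ofCoords]
    rfl
  rw [h, Algebra.norm_tensorProduct_map, ← normForm, ← sub_eq_zero, ← map_one
    (Ideal.Quotient.mkₐ k (Ideal.span {normForm k F - 1})), ← map_sub]
  exact Ideal.Quotient.eq_zero_iff_mem.2 (Ideal.mem_span_singleton_self _)

/-- The `R`-valued point of the norm torus given by an element of norm one of `R ⊗ F`. -/
noncomputable def normTorusLift (u : R ⊗[k] F) (hu : Algebra.norm R u = 1) :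
    NormTorusRing k F →ₐ[k] R :=
  Ideal.Quotient.liftₐ _ (MvPolynomial.aeval ((ofCoords F).symm u)) (by
    intro a ha
    rw [← RingHom.mem_ker]
    refine (Ideal.span_le (I := RingHom.ker _)).2 ?_ ha
    simp [RingHom.mem_ker, normForm_aeval_ofCoords_symm, hu])

lemma map_normTorusLift_normTorusPoint (u : R ⊗[k] F) (hu : Algebra.norm R u = 1) :
    Algebra.TensorProduct.map (normTorusLift F u hu) (AlgHom.id k F) (normTorusPoint k F) = u := by
  rw [normTorusPoint, map_ofCoords, ← LinearEquiv.eq_symm_apply]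
  ext i
  exact MvPolynomial.aeval_X ((ofCoords F).symm u) i

variable {F} in
lemma normTorus_algHom_ext {f g : NormTorusRing k F →ₐ[k] R}
    (h : Algebra.TensorProduct.map f (AlgHom.id k F) (normTorusPoint k F) =
      Algebra.TensorProduct.map g (AlgHom.id k F) (normTorusPoint k F)) : f = g := by
  rw [normTorusPoint, map_ofCoords, map_ofCoords, (ofCoords F).injective.eq_iff] at h
  refine Ideal.Quotient.algHom_ext _ (MvPolynomial.algHom_ext fun i ↦ ?_)
  exact congrFun h i

lemma normForm_ne_zero : normForm k F ≠ 0 := by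
  intro h
  have := normForm_aeval_ofCoords_symm F (1 : k ⊗[k] F)
  simp [h] at this

end Points

/-- The polynomial ring over `A` is flat over the one over `E`, so nonzero polynomials over the
field `E` stay regular; `A` need not be a domain. -/
lemma MvPolynomial.map_algebraMap_mem_nonZeroDivisors {σ E A : Type*} [Field E] [CommRing A]
    [Algebra E A] {g : MvPolynomial σ E} (hg : g ≠ 0) :
    MvPolynomial.map (algebraMap E A) g ∈ nonZeroDivisors (MvPolynomial σ A) := by
  let := MvPolynomial.algebraMvPolynomial (R := E) (S := A) (σ := σ)
  have : Module.Flat (MvPolynomial σ E) (MvPolynomial σ A) :=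
    Module.Flat.isBaseChange _ _ _ _
      (Algebra.IsPushout.out (R := E) (S := MvPolynomial σ E) (R' := A) (S' := MvPolynomial σ A))
  have h := Module.Flat.isSMulRegular_of_nonZeroDivisors (M := MvPolynomial σ A)
    (mem_nonZeroDivisors_of_ne_zero hg)
  rw [mem_nonZeroDivisors_iff_right]
  intro x hx
  refine h ?_
  simpa [Algebra.smul_def, mul_comm] using hx

/-! ### The norm torus of a product of copies of a field -/

section Splitting

variable {k E F K : Type u} [Field k] [Field E] [Field F] [Field K] [Algebra k E] [Algebra k F]
  [Algebra E K]

section Scalars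

variable {I : Type*} [Finite I] (e : E ⊗[k] F ≃ₐ[E] (I → K))
variable (R R' : Type u) [CommRing R] [Algebra k R] [Algebra E R] [IsScalarTower k E R]
  [CommRing R'] [Algebra k R'] [Algebra E R'] [IsScalarTower k E R']

/-- The isomorphism `R ⊗ₖ F ≃ (R ⊗_E K)^I` of algebras over an `E`-algebra `R` induced by an
isomorphism `E ⊗ₖ F ≃ K^I`. -/
noncomputable def splitting : R ⊗[k] F ≃ₐ[R] (I → R ⊗[E] K) :=
  haveI := Fintype.ofFinite I
  haveI := Classical.decEq I
  (Algebra.TensorProduct.cancelBaseChange k E R R F).symm.trans <|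
    (Algebra.TensorProduct.congr (AlgEquiv.refl : R ≃ₐ[R] R) e).trans
      (Algebra.TensorProduct.piRight E R R fun _ : I ↦ K)

lemma splitting_tmul (x : R) (y : F) (i : I) :
    splitting e R (x ⊗ₜ y) i = x ⊗ₜ e (1 ⊗ₜ y) i := by
  simp [splitting]

variable {R R'} in
lemma splitting_map (f : R →ₐ[E] R') (x : R ⊗[k] F) (i : I) :
    splitting e R' (Algebra.TensorProduct.map (f.restrictScalars k) (AlgHom.id k F) x) i =
      Algebra.TensorProduct.map f (AlgHom.id E K) (splitting e R x i) := by
  induction x with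
  | zero => simp
  | tmul x y => simp [splitting_tmul]
  | add x y hx hy => simp [hx, hy]

variable {R} in
lemma norm_eq_prod_norm_splitting [Fintype I] [FiniteDimensional E K] (x : R ⊗[k] F) :
    Algebra.norm R x = ∏ i, Algebra.norm R (splitting e R x i) := by
  rw [← Algebra.norm_pi, Algebra.norm_eq_of_algEquiv]

end Scalars

variable (k E F) in
/-- The coordinate ring `E ⊗ k[T]` of the base change to `E` of the norm torus `T` of `F / k`. It is
a type synonym, so that it enters further tensor products only through its ring structure. -/
def ExtendedTorusRing [FiniteDimensional k F] : Type u := E ⊗[k] NormTorusRing k F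

namespace ExtendedTorusRing

variable [FiniteDimensional k F]

noncomputable instance : CommRing (ExtendedTorusRing k E F) :=
  inferInstanceAs (CommRing (E ⊗[k] NormTorusRing k F))

noncomputable instance : Algebra E (ExtendedTorusRing k E F) :=
  inferInstanceAs (Algebra E (E ⊗[k] NormTorusRing k F))

noncomputable instance : Algebra k (ExtendedTorusRing k E F) :=
  inferInstanceAs (Algebra k (E ⊗[k] NormTorusRing k F))

instance : IsScalarTower k E (ExtendedTorusRing k E F) :=
  inferInstanceAs (IsScalarTower k E (E ⊗[k] NormTorusRing k F))

variable (k E F) in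
/-- The identification with the tensor product. -/
noncomputable def equivTensor : ExtendedTorusRing k E F ≃ₐ[E] E ⊗[k] NormTorusRing k F :=
  AlgEquiv.refl

variable (k E F) in
/-- The canonical map from the coordinate ring of the norm torus to that of its base change. -/
noncomputable def of : NormTorusRing k F →ₐ[k] ExtendedTorusRing k E F :=
  Algebra.TensorProduct.includeRight

variable {R : Type u} [CommRing R] [Algebra k R] [Algebra E R] [IsScalarTower k E R]

/-- Extension of scalars of an algebra homomorphism. -/
noncomputable def lift (f : NormTorusRing k F →ₐ[k] R) : ExtendedTorusRing k E F →ₐ[E] R :=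
  Algebra.TensorProduct.lift (Algebra.ofId E R) f fun _ _ ↦ .all _ _

lemma lift_comp_of (f : NormTorusRing k F →ₐ[k] R) :
    ((lift f : ExtendedTorusRing k E F →ₐ[E] R).restrictScalars k).comp (of k E F) = f :=
  Algebra.TensorProduct.lift_comp_includeRight (S := E) _ _ _

lemma algHom_ext {f g : ExtendedTorusRing k E F →ₐ[E] R}
    (h : (f.restrictScalars k).comp (of k E F) = (g.restrictScalars k).comp (of k E F)) : f = g :=
  Algebra.TensorProduct.ext (S := E) (Subsingleton.elim _ _) h

end ExtendedTorusRing

/-- The coordinate ring of the product of the norm torus of `K / E` and of `J` copies of the affine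
space underlying `K`. It is a type synonym of a polynomial ring, so that it enters tensor products
only through its ring structure. -/
def ProductRing (E K J : Type u) [Field E] [Field K] [Algebra E K] [FiniteDimensional E K] :
    Type u :=
  MvPolynomial (J × ULift.{u} (Fin (Module.finrank E K))) (NormTorusRing E K)

namespace ProductRing

variable [FiniteDimensional E K] {J : Type u}

noncomputable instance : CommRing (ProductRing E K J) :=
  inferInstanceAs (CommRing (MvPolynomial _ (NormTorusRing E K)))

noncomputable instance : Algebra E (ProductRing E K J) :=
  inferInstanceAs (Algebra E (MvPolynomial _ (NormTorusRing E K)))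

variable (E K J) in
/-- The identification with the polynomial ring. -/
noncomputable def equivMvPolynomial : ProductRing E K J ≃ₐ[E]
    MvPolynomial (J × ULift.{u} (Fin (Module.finrank E K))) (NormTorusRing E K) :=
  AlgEquiv.refl

variable (E K J) in
/-- The inclusion of the coordinate ring of the norm torus. -/
noncomputable def of : NormTorusRing E K →ₐ[E] ProductRing E K J :=
  IsScalarTower.toAlgHom E (NormTorusRing E K) (MvPolynomial _ (NormTorusRing E K))

variable (E K) in
/-- The coordinates of the affine space factors. -/
noncomputable def X (j : J) (l : Fin (Module.finrank E K)) : ProductRing E K J :=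
  MvPolynomial.X (j, ULift.up l)

variable {R : Type u} [CommRing R] [Algebra E R]

/-- The universal property of the polynomial ring. -/
noncomputable def lift (f : NormTorusRing E K →ₐ[E] R) (v : J → Fin (Module.finrank E K) → R) :
    ProductRing E K J →ₐ[E] R :=
  MvPolynomial.aevalTower f fun p ↦ v p.1 p.2.down

lemma lift_comp_of (f : NormTorusRing E K →ₐ[E] R) (v : J → Fin (Module.finrank E K) → R) :
    (lift f v).comp (of E K J) = f :=
  AlgHom.ext fun x ↦ MvPolynomial.aevalTower_C _ _ x

lemma lift_X (f : NormTorusRing E K →ₐ[E] R) (v : J → Fin (Module.finrank E K) → R) (j : J)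
    (l : Fin (Module.finrank E K)) : lift f v (X E K j l) = v j l :=
  MvPolynomial.aevalTower_X _ _ _

lemma algHom_ext {f g : ProductRing E K J →ₐ[E] R}
    (h : f.comp (of E K J) = g.comp (of E K J)) (h' : ∀ j l, f (X E K j l) = g (X E K j l)) :
    f = g :=
  MvPolynomial.algHom_ext' h fun p ↦ h' p.1 p.2.down

end ProductRing

variable [FiniteDimensional k F]
variable {J : Type u} [Fintype J] (e : E ⊗[k] F ≃ₐ[E] (Option J → K))

variable (k E F) in
/-- The tautological point of the norm torus of `F / k` with scalars extended to `E`. -/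
noncomputable def extendedPoint : ExtendedTorusRing k E F ⊗[k] F :=
  Algebra.TensorProduct.map (ExtendedTorusRing.of k E F) (AlgHom.id k F) (normTorusPoint k F)

/-- The components of the tautological point over `E`. -/
noncomputable def extendedComponent (i : Option J) : (ExtendedTorusRing k E F) ⊗[E] K :=
  splitting e _ (extendedPoint k E F) i

variable {R : Type u} [CommRing R] [Algebra k R] [Algebra E R] [IsScalarTower k E R]

lemma extended_algHom_ext {f g : ExtendedTorusRing k E F →ₐ[E] R}
    (h : ∀ i, Algebra.TensorProduct.map f (AlgHom.id E K) (extendedComponent e i) =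
      Algebra.TensorProduct.map g (AlgHom.id E K) (extendedComponent e i)) : f = g := by
  simp only [extendedComponent, ← splitting_map] at h
  have h' := (splitting e R).injective (funext h)
  simp only [extendedPoint, ← AlgHom.comp_apply, ← Algebra.TensorProduct.map_comp,
    AlgHom.comp_id] at h'
  have := normTorus_algHom_ext h'
  exact ExtendedTorusRing.algHom_ext this

variable [FiniteDimensional E K]

lemma prod_norm_extendedComponent :
    ∏ i, Algebra.norm (ExtendedTorusRing k E F) (extendedComponent e i) = 1 := by
  simp only [extendedComponent]
  rw [← norm_eq_prod_norm_splitting, extendedPoint, Algebra.norm_tensorProduct_map,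
    norm_normTorusPoint, map_one]

lemma isUnit_norm_extendedComponent (i : Option J) :
    IsUnit (Algebra.norm (ExtendedTorusRing k E F) (extendedComponent e i)) :=
  isUnit_of_dvd_one ((Finset.dvd_prod_of_mem _ (Finset.mem_univ i)).trans
    (prod_norm_extendedComponent e).dvd)

variable (E K) in
/-- The tautological point of the `j`-th affine space factor. -/
noncomputable def affinePoint (j : J) : ProductRing E K J ⊗[E] K :=
  ofCoords K fun l ↦ ProductRing.X E K j l

variable (E K J) in
/-- The tautological point of the norm torus factor. -/
noncomputable def torusPoint : ProductRing E K J ⊗[E] K :=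
  Algebra.TensorProduct.map (ProductRing.of E K J)
    (AlgHom.id E K) (normTorusPoint E K)

variable (E K J) in
/-- The product of the norm forms of the affine space factors. -/
noncomputable def normProduct : ProductRing E K J :=
  ∏ j : J, Algebra.norm (ProductRing E K J) (affinePoint E K j)

/-- The map on coordinate rings which, on points `(u_i)` of the torus over `E` viewed in
`K ^ (Option J)`, is `(u_i) ↦ (∏ i, u_i, (u_j)_j)` with `j` running over `J` only. -/
noncomputable def productRingHom : ProductRing E K J →ₐ[E] ExtendedTorusRing k E F :=
  ProductRing.lift
    (normTorusLift K (∏ i, extendedComponent e i)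
      (by rw [map_prod, prod_norm_extendedComponent]))
    fun j ↦ (ofCoords K).symm (extendedComponent e (some j))

lemma map_productRingHom_affinePoint (j : J) :
    Algebra.TensorProduct.map (productRingHom e) (AlgHom.id E K) (affinePoint E K j) =
      extendedComponent e (some j) := by
  rw [affinePoint, map_ofCoords]
  simp [productRingHom, ProductRing.lift_X]

lemma map_productRingHom_torusPoint :
    Algebra.TensorProduct.map (productRingHom e) (AlgHom.id E K) (torusPoint E K J) =
      ∏ i, extendedComponent e i := by
  rw [torusPoint, ← AlgHom.comp_apply, ← Algebra.TensorProduct.map_comp, AlgHom.comp_id]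
  have : (productRingHom e).comp (ProductRing.of E K J) =
      normTorusLift K (∏ i, extendedComponent e i)
      (by rw [map_prod, prod_norm_extendedComponent]) := by
    rw [productRingHom, ProductRing.lift_comp_of]
  rw [this, map_normTorusLift_normTorusPoint]

lemma isUnit_productRingHom_normProduct : IsUnit (productRingHom e (normProduct E K J)) := by
  rw [normProduct, map_prod]
  refine IsUnit.prod_univ_iff.2 fun j ↦ ?_
  rw [← Algebra.norm_tensorProduct_map, map_productRingHom_affinePoint]
  exact isUnit_norm_extendedComponent e _

/-- The missing component of the tautological point is recovered from the product of all components,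
since the components are units. -/
lemma productRingHom_hom_ext {f g : ExtendedTorusRing k E F →ₐ[E] R}
    (h : f.comp (productRingHom e) = g.comp (productRingHom e)) : f = g := by
  have h1 (j : J) : Algebra.TensorProduct.map f (AlgHom.id E K) (extendedComponent e (some j)) =
      Algebra.TensorProduct.map g (AlgHom.id E K) (extendedComponent e (some j)) := by
    rw [← map_productRingHom_affinePoint, ← AlgHom.comp_apply, ← AlgHom.comp_apply,
      ← Algebra.TensorProduct.map_comp, ← Algebra.TensorProduct.map_comp, h]
  have h2 : Algebra.TensorProduct.map f (AlgHom.id E K) (∏ i, extendedComponent e i) =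
      Algebra.TensorProduct.map g (AlgHom.id E K) (∏ i, extendedComponent e i) := by
    rw [← map_productRingHom_torusPoint, ← AlgHom.comp_apply, ← AlgHom.comp_apply,
      ← Algebra.TensorProduct.map_comp, ← Algebra.TensorProduct.map_comp, h]
  refine extended_algHom_ext e fun i ↦ ?_
  cases i with
  | some j => exact h1 j
  | none =>
    rw [map_prod, map_prod, Fintype.prod_option, Fintype.prod_option] at h2
    simp only [h1] at h2
    refine (IsUnit.mul_left_inj ?_).1 h2
    rw [IsUnit.prod_univ_iff]
    exact fun j ↦ (Algebra.isUnit_of_isUnit_norm (isUnit_norm_extendedComponent e _)).map _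

/-- Where the norms of the `z_j` are invertible, so are the `z_j`, and there is an inverse
coordinate change `(w, (z_j)_j) ↦ (w * ∏ j, z_j⁻¹, (z_j)_j)`. -/
lemma exists_comp_productRingHom (f : ProductRing E K J →ₐ[E] R)
    (hf : IsUnit (f (normProduct E K J))) :
    ∃ g : ExtendedTorusRing k E F →ₐ[E] R, g.comp (productRingHom e) = f := by
  let z (j : J) : R ⊗[E] K := Algebra.TensorProduct.map f (AlgHom.id E K) (affinePoint E K j)
  let w : R ⊗[E] K := Algebra.TensorProduct.map f (AlgHom.id E K) (torusPoint E K J)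
  have hw : Algebra.norm R w = 1 := by
    simp only [w, torusPoint, Algebra.norm_tensorProduct_map, norm_normTorusPoint, map_one]
  have hz : IsUnit (∏ j, z j) := by
    refine Algebra.isUnit_of_isUnit_norm (R := R) ?_
    simpa only [z, map_prod, Algebra.norm_tensorProduct_map, normProduct] using hf
  obtain ⟨y, hy⟩ := hz.exists_left_inv
  let v : Option J → R ⊗[E] K := fun i ↦ i.elim (w * y) z
  have hv : ∏ i, v i = w := by
    rw [Fintype.prod_option]
    simp only [v, Option.elim, mul_assoc, hy, mul_one]
  have hv' : Algebra.norm R ((splitting e R).symm v) = 1 := by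
    rw [norm_eq_prod_norm_splitting e, AlgEquiv.apply_symm_apply, ← map_prod, hv, hw]
  let g : ExtendedTorusRing k E F →ₐ[E] R :=
    ExtendedTorusRing.lift (normTorusLift F _ hv')
  have hg (i : Option J) :
      Algebra.TensorProduct.map g (AlgHom.id E K) (extendedComponent e i) = v i := by
    have : (g.restrictScalars k).comp (ExtendedTorusRing.of k E F) = normTorusLift F _ hv' :=
      ExtendedTorusRing.lift_comp_of _
    rw [extendedComponent, ← splitting_map, extendedPoint, ← AlgHom.comp_apply,
      ← Algebra.TensorProduct.map_comp, AlgHom.comp_id, this, map_normTorusLift_normTorusPoint,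
      AlgEquiv.apply_symm_apply]
  refine ⟨g, ProductRing.algHom_ext (normTorus_algHom_ext ?_) fun j l ↦ ?_⟩
  · have h1 : Algebra.TensorProduct.map (g.comp (productRingHom e)) (AlgHom.id E K)
        (torusPoint E K J) = w := by
      rw [← AlgHom.comp_id (AlgHom.id E K), Algebra.TensorProduct.map_comp, AlgHom.comp_apply,
        map_productRingHom_torusPoint, map_prod]
      simp only [hg, hv]
    simp only [w, torusPoint] at h1
    simpa only [← AlgHom.comp_apply, ← Algebra.TensorProduct.map_comp, AlgHom.comp_id] using h1
  · have h1 : Algebra.TensorProduct.map (g.comp (productRingHom e)) (AlgHom.id E K)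
        (affinePoint E K j) = z j := by
      rw [← AlgHom.comp_id (AlgHom.id E K), Algebra.TensorProduct.map_comp, AlgHom.comp_apply,
        map_productRingHom_affinePoint, hg]
      rfl
    simp only [z, affinePoint, map_ofCoords] at h1
    exact congrFun ((ofCoords K).injective h1) l

/-- Over `E`, the norm torus of `F / k` is the open subscheme of the product of the norm torus of
`K / E` and of copies of the affine space underlying `K` where the norm forms do not vanish. -/
lemma isLocalization_productRingHom :
    letI := (productRingHom e).toAlgebra
    IsLocalization.Away (normProduct E K J) (ExtendedTorusRing k E F) := by
  let := (productRingHom e).toAlgebra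
  let D := Localization.Away (normProduct E K J)
  let := Algebra.compHom D (algebraMap k E)
  have : IsScalarTower k E D := .of_algebraMap_eq fun _ ↦ rfl
  obtain ⟨g, hg⟩ := exists_comp_productRingHom e (IsScalarTower.toAlgHom E (ProductRing E K J) D)
    (IsLocalization.Away.algebraMap_isUnit (normProduct E K J))
  have hg (x : ProductRing E K J) : g (productRingHom e x) = algebraMap _ D x := congr($hg x)
  let f : D →+* ExtendedTorusRing k E F :=
    IsLocalization.Away.lift (normProduct E K J) (g := (productRingHom e).toRingHom)
      (isUnit_productRingHom_normProduct e)
  have hf (x : ProductRing E K J) : f (algebraMap _ D x) = productRingHom e x :=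
    IsLocalization.Away.lift_eq _ _ _
  let f' : D →ₐ[E] ExtendedTorusRing k E F :=
    { f with
      commutes' := fun x ↦ by
        refine (congrArg f (IsScalarTower.algebraMap_apply E (ProductRing E K J) D x)).trans ?_
        rw [hf, AlgHom.commutes] }
  have h1 : f'.comp g = AlgHom.id E _ :=
    productRingHom_hom_ext e <| AlgHom.ext fun x ↦ (congrArg f (hg x)).trans (hf x)
  have h2 : g.toRingHom.comp f = RingHom.id D :=
    IsLocalization.ringHom_ext (Submonoid.powers (normProduct E K J)) <| RingHom.ext fun x ↦
      (congrArg g (hf x)).trans (hg x)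
  exact IsLocalization.isLocalization_of_algEquiv (Submonoid.powers (normProduct E K J))
    (AlgEquiv.ofRingEquiv (f := RingEquiv.ofRingHom f g.toRingHom
      (RingHom.ext fun x ↦ congr($h1 x)) h2) hf)

variable (E K J) in
lemma normProduct_mem_nonZeroDivisors :
    normProduct E K J ∈ nonZeroDivisors (ProductRing E K J) := by
  refine prod_mem (S := nonZeroDivisors (ProductRing E K J)) fun j _ ↦ ?_
  have h : ProductRing.equivMvPolynomial E K J
      (Algebra.norm (ProductRing E K J) (affinePoint E K j)) =
      MvPolynomial.map (algebraMap E (NormTorusRing E K))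
        (MvPolynomial.rename (fun l ↦ (j, ULift.up l)) (normForm E K)) := by
    rw [affinePoint, norm_ofCoords]
    have h : (ProductRing.equivMvPolynomial E K J).toAlgHom.comp
        (MvPolynomial.aeval (ProductRing.X E K j)) =
        (MvPolynomial.mapAlgHom (Algebra.ofId E (NormTorusRing E K))).comp
          (MvPolynomial.rename fun l ↦ (j, ULift.up l)) := by
      refine MvPolynomial.algHom_ext fun l ↦ ?_
      rw [AlgHom.comp_apply, AlgHom.comp_apply, MvPolynomial.aeval_X, MvPolynomial.rename_X]
      exact (MvPolynomial.map_X _ _).symm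
    exact congr($h (normForm E K))
  have hN := MvPolynomial.map_algebraMap_mem_nonZeroDivisors (A := NormTorusRing E K)
    (g := MvPolynomial.rename (fun l ↦ (j, ULift.up.{u} l)) (normForm E K))
    ((map_ne_zero_iff _ (MvPolynomial.rename_injective _ fun a b h ↦ by simpa using h)).2
      (normForm_ne_zero K))
  rw [mem_nonZeroDivisors_iff_right] at hN ⊢
  intro x hx
  refine (map_eq_zero_iff _ (ProductRing.equivMvPolynomial E K J).injective).1 (hN _ ?_)
  rw [← h, ← map_mul, hx, map_zero]

/-- Stable rationality of the norm torus of `F / k` implies that of the norm torus of `K / E`, if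
`E ⊗ F` is a product of copies of `K`. -/
lemma IsStablyRational.of_splitting (e : E ⊗[k] F ≃ₐ[E] (Option J → K))
    (h : IsStablyRational (normTorusHom k F)) : IsStablyRational (normTorusHom E K) := by
  let := (productRingHom e).toAlgebra
  have := isLocalization_productRingHom e
  have : IsScalarTower E (ProductRing E K J) (ExtendedTorusRing k E F) :=
    .of_algebraMap_eq fun x ↦ ((productRingHom e).commutes x).symm
  exact h.of_away_tensorProduct (ProductRing.equivMvPolynomial E K J)
    (ExtendedTorusRing.equivTensor k E F) (normProduct E K J)
    (IsLocalization.injective (M := Submonoid.powers (normProduct E K J)) _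
      (Submonoid.powers_le.2 (normProduct_mem_nonZeroDivisors E K J)))

end Splitting

/-! ### Embeddings and the Galois group -/

lemma isNormalClosure_algebraicClosure (k F : Type*) [Field k] [Field F] [Algebra k F]
    [Algebra.IsAlgebraic k F] :
    IsNormalClosure k F (IntermediateField.normalClosure k F (AlgebraicClosure F)) :=
  Algebra.IsAlgebraic.isNormalClosure_normalClosure fun y ↦ by
    rw [← minpoly.algebraMap_eq (algebraMap F (AlgebraicClosure F)).injective]
    exact IsAlgClosed.splits _

lemma isGalois_normalClosure_algebraicClosure (k F : Type*) [Field k] [Field F] [Algebra k F]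
    [Algebra.IsSeparable k F] :
    IsGalois k (IntermediateField.normalClosure k F (AlgebraicClosure F)) where
  to_isSeparable := (le_separableClosure_iff k _ _).1 <| iSup_le fun x ↦
    have : Algebra.IsSeparable k x.fieldRange :=
      AlgEquiv.Algebra.isSeparable (AlgEquiv.ofInjectiveField x)
    le_separableClosure k _ _
  to_normal := (isNormalClosure_algebraicClosure k F).normal

/-- Dedekind's theorem on independence of characters: the matrix of the values of the embeddings on
a basis is invertible if there are as many embeddings as the degree. -/
lemma eq_zero_of_forall_algHom {k F L X ι : Type*} [Field k] [Field F] [Field L] [Algebra k F]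
    [Algebra k L] [Fintype ι] [Finite X] (b : Module.Basis ι k F) (x : X → F →ₐ[k] L)
    (hx : Function.Injective x) (hc : Nat.card X = Fintype.card ι) (a : ι → L)
    (h : ∀ t, ∑ i, a i * x t (b i) = 0) : a = 0 := by
  classical
  have : Fintype X := .ofFinite X
  rw [Nat.card_eq_fintype_card] at hc
  let eq := Fintype.equivOfCardEq hc
  let M : Matrix ι ι L := .of fun j i ↦ x (eq.symm j) (b i)
  have hM : IsUnit M := by
    rw [← Matrix.linearIndependent_rows_iff_isUnit]
    have hli := (linearIndependent_toLinearMap k F L).comp _ (hx.comp eq.symm.injective)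
    have hli' := hli.map' (b.constr L).symm.toLinearMap (LinearEquiv.ker _)
    have hM : M.row = (b.constr L).symm.toLinearMap ∘ AlgHom.toLinearMap ∘ x ∘ eq.symm := by
      ext j i
      simp [M]
    rw [hM]
    exact hli'
  have h' : M.mulVec a = 0 := by
    ext j
    simpa [M, Matrix.mulVec, dotProduct, mul_comm] using h (eq.symm j)
  exact Matrix.mulVec_injective_of_isUnit hM (by rw [h', Matrix.mulVec_zero])

section Action

variable (k F L : Type*) [Field k] [Field F] [Field L] [Algebra k F] [Algebra k L]

/-- The action of the Galois group of `L / k` on the embeddings of `F` in `L`. -/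
def galoisPerm : Gal(L/k) →* Equiv.Perm (F →ₐ[k] L) where
  toFun σ :=
    { toFun x := σ.toAlgHom.comp x
      invFun x := σ.symm.toAlgHom.comp x
      left_inv x := by ext; simp
      right_inv x := by ext; simp }
  map_one' := rfl
  map_mul' _ _ := rfl

variable {k F L}

lemma galoisPerm_apply (σ : Gal(L/k)) (x : F →ₐ[k] L) (y : F) :
    galoisPerm k F L σ x y = σ (x y) := rfl

lemma galoisPerm_injective (hL : IntermediateField.normalClosure k F L = ⊤) :
    Function.Injective (galoisPerm k F L) := by
  rw [injective_iff_map_eq_one]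
  intro σ hσ
  have h : IntermediateField.normalClosure k F L ≤
      IntermediateField.fixedField (Subgroup.zpowers σ) := by
    refine iSup_le fun x ↦ ?_
    rintro _ ⟨y, rfl⟩
    have hy : σ (x y) = x y := by
      rw [← galoisPerm_apply, hσ]; rfl
    rw [IntermediateField.mem_fixedField_iff]
    intro τ hτ
    have : Subgroup.zpowers σ ≤ MulAction.stabilizer Gal(L/k) (x y) := by
      rw [Subgroup.zpowers_le]; exact hy
    exact this hτ
  ext z
  rw [hL] at h
  have := h (IntermediateField.mem_top (x := z))
  rw [IntermediateField.mem_fixedField_iff] at this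
  exact this σ (Subgroup.mem_zpowers σ)

/-- The Galois group of a generic extension realizes all permutations of the embeddings: its action
is faithful and it has the right order. The isomorphism with the symmetric group in the definition
is only used to count. -/
lemma galoisPerm_bijective_of_equiv {k F L : Type*} [Field k] [Field F] [Field L]
    [Algebra k F] [Algebra k L] {n : ℕ} (hL : IntermediateField.normalClosure k F L = ⊤)
    (hcard : Nat.card (F →ₐ[k] L) = n) [Finite (F →ₐ[k] L)]
    (φ : Gal(L/k) ≃* Equiv.Perm (Fin n)) : Function.Bijective (galoisPerm k F L) := by
  rw [Nat.bijective_iff_injective_and_card]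
  refine ⟨galoisPerm_injective hL, ?_⟩
  rw [Nat.card_congr φ.toEquiv, Nat.card_perm, Nat.card_perm, hcard, Nat.card_fin]

end Action

section Blocks

variable {k F E L : Type u} [Field k] [Field F] [Field E] [Field L] [Algebra k F] [Algebra k L]
  [Algebra k E] [Algebra E L] [IsScalarTower k E L]
  {I J : Type*} (x : J → I → F →ₐ[k] L) (γ : Equiv.Perm I ≃* Gal(L/E)) (i₀ : I)

/-- The fixed field in `L` of the stabilizer of a letter, for a Galois group identified with a
symmetric group. -/
noncomputable def letterField : IntermediateField E L :=
  IntermediateField.fixedField ((MulAction.stabilizer (Equiv.Perm I) i₀).map γ.toMonoidHom)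

lemma mem_letterField {y : L} :
    y ∈ letterField γ i₀ ↔ ∀ π : Equiv.Perm I, π i₀ = i₀ → γ π y = y := by
  simp [letterField, IntermediateField.mem_fixedField_iff]

lemma finrank_letterField [FiniteDimensional E L] [IsGalois E L] :
    Module.finrank E (letterField γ i₀) = Nat.card I := by
  rw [IntermediateField.finrank_eq_fixingSubgroup_index, letterField,
    IntermediateField.fixingSubgroup_fixedField, Subgroup.index_map_of_bijective,
    MulAction.index_stabilizer_of_transitive]
  exact γ.bijective

/-- The embeddings of `F` in the field fixed by the stabilizer of a letter, one for each block. -/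
noncomputable def embLetterField (hx : ∀ π j i y, γ π (x j i y) = x j (π i) y) (j : J) :
    F →ₐ[k] letterField γ i₀ where
  toFun y := ⟨x j i₀ y, (mem_letterField γ i₀).2 fun π hπ ↦ by rw [hx, hπ]⟩
  map_one' := Subtype.ext (map_one _)
  map_zero' := Subtype.ext (map_zero _)
  map_mul' _ _ := Subtype.ext (map_mul _ _ _)
  map_add' _ _ := Subtype.ext (map_add _ _ _)
  commutes' c := Subtype.ext ((x j i₀).commutes c)

lemma coe_embLetterField (hx : ∀ π j i y, γ π (x j i y) = x j (π i) y) (j : J) (y : F) :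
    (embLetterField x γ i₀ hx j y : L) = x j i₀ y := rfl

/-- The blocks of embeddings split `F` over `E` into copies of the letter field. -/
lemma exists_tensorProduct_equiv (hx : ∀ π j i y, γ π (x j i y) = x j (π i) y)
    [Finite I] [Finite J] [FiniteDimensional k F] [FiniteDimensional E L] [IsGalois E L]
    (hinj : Function.Injective fun p : J × I ↦ x p.1 p.2)
    (hcard : Module.finrank k F = Nat.card J * Nat.card I) :
    Nonempty (E ⊗[k] F ≃ₐ[E] (J → letterField γ i₀)) := by
  have := Fintype.ofFinite J
  let f : E ⊗[k] F →ₐ[E] (J → letterField γ i₀) := AlgHom.pi fun j ↦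
    Algebra.TensorProduct.lift (Algebra.ofId E _) (embLetterField x γ i₀ hx j) fun _ _ ↦ .all _ _
  have hf (a : E) (y : F) (j : J) : (f (a ⊗ₜ y) j : L) = algebraMap E L a * x j i₀ y := by
    simp [f, coe_embLetterField]
  have hinj : Function.Injective f.toLinearMap := by
    rw [← LinearMap.ker_eq_bot, LinearMap.ker_eq_bot']
    intro u hu
    let b := (Module.finBasis k F).baseChange E
    have hb := b.sum_repr u
    have ha : (fun i ↦ algebraMap E L (b.repr u i)) = 0 := by
      refine eq_zero_of_forall_algHom (Module.finBasis k F) (fun p : J × I ↦ x p.1 p.2) hinj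
        (by simp [hcard]) _ ?_
      rintro ⟨j, i⟩
      classical
      -- the component of `u` in the block `j`, moved to the letter `i` by the Galois group
      have h0 := congr(γ (Equiv.swap i₀ i) ($hu j : L))
      rw [← hb] at h0
      simpa [b, TensorProduct.smul_tmul', hf, hx] using h0
    rw [← hb]
    refine Finset.sum_eq_zero fun i _ ↦ ?_
    have := congrFun ha i
    rw [Pi.zero_apply, map_eq_zero] at this
    rw [this, zero_smul]
  refine ⟨AlgEquiv.ofBijective f ⟨hinj, ?_⟩⟩
  refine (LinearMap.injective_iff_surjective_of_finrank_eq_finrank ?_).1 hinj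
  rw [Module.finrank_baseChange, hcard, Module.finrank_pi_fintype]
  simp [finrank_letterField]

/-- The Galois group moves each letter to every other, so the conjugates of the letter field contain
the images of all embeddings of `F`, and these generate `L`. -/
lemma isNormalClosure_letterField (hx : ∀ π j i y, γ π (x j i y) = x j (π i) y)
    [FiniteDimensional E L] [IsGalois E L]
    (hsurj : Function.Surjective fun p : J × I ↦ x p.1 p.2)
    (hL : IntermediateField.normalClosure k F L = ⊤) : IsNormalClosure E (letterField γ i₀) L := by
  classical
  refine Algebra.IsAlgebraic.isNormalClosure_iff.2 ⟨fun z ↦ ?_, ?_⟩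
  · rw [← minpoly.algebraMap_eq (algebraMap (letterField γ i₀) L).injective]
    exact Normal.splits inferInstance _
  · have h : IntermediateField.normalClosure k F L ≤
        (IntermediateField.normalClosure E (letterField γ i₀) L).restrictScalars k := by
      refine iSup_le fun z ↦ ?_
      obtain ⟨⟨j, i⟩, rfl⟩ := hsurj z
      rintro _ ⟨y, rfl⟩
      refine (γ (Equiv.swap i₀ i)).toAlgHom.comp (letterField γ i₀).val
        |>.fieldRange_le_normalClosure ⟨embLetterField x γ i₀ hx j y, ?_⟩
      refine (hx (Equiv.swap i₀ i) j i₀ y).trans ?_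
      rw [Equiv.swap_apply_left]
      rfl
    rw [hL] at h
    exact top_le_iff.1 fun z hz ↦ h IntermediateField.mem_top

/-- The field fixed by the stabilizer of a letter is a generic extension. -/
lemma isGenericExtension_letterField (hx : ∀ π j i y, γ π (x j i y) = x j (π i) y)
    [Finite I] [FiniteDimensional E L] [IsGalois E L]
    (hsurj : Function.Surjective fun p : J × I ↦ x p.1 p.2)
    (hL : IntermediateField.normalClosure k F L = ⊤) :
    IsGenericExtension E (letterField γ i₀) (Nat.card I) where
  finiteDimensional := inferInstance
  isSeparable := inferInstance
  finrank_eq := finrank_letterField γ i₀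
  gal_equiv := by
    have := isNormalClosure_letterField x γ i₀ hx hsurj hL
    let N := IntermediateField.normalClosure E (letterField γ i₀)
      (AlgebraicClosure (letterField γ i₀))
    have : IsNormalClosure E (letterField γ i₀) N := isNormalClosure_algebraicClosure _ _
    let φ : N ≃ₐ[E] L := IsNormalClosure.equiv (K := letterField γ i₀)
    exact ⟨(AlgEquiv.autCongr φ).trans (γ.symm.trans (Finite.equivFin I).permCongrHom)⟩

end Blocks

section Diagonal

variable {k F L : Type u} [Field k] [Field F] [Field L] [Algebra k F] [Algebra k L]
  {I J : Type*}

/-- If the Galois group is the full symmetric group on the embeddings of `F`, these can be arranged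
in a `J × I` array in which the group permuting the columns is the Galois group over some
intermediate field `E`. -/
lemma exists_diagonal_perm [Nonempty J] [FiniteDimensional k L]
    (h : Function.Bijective (galoisPerm k F L)) (x : J × I ≃ (F →ₐ[k] L)) :
    ∃ (E : IntermediateField k L) (γ : Equiv.Perm I ≃* Gal(L/E)),
      ∀ π j i y, γ π (x (j, i) y) = x (j, π i) y := by
  let ρ : Equiv.Perm I →* Gal(L/k) :=
    (MulEquiv.ofBijective _ h).symm.toMonoidHom.comp <| x.permCongrHom.toMonoidHom.comp
      { toFun π := Equiv.prodCongr (Equiv.refl J) π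
        map_one' := rfl
        map_mul' _ _ := rfl }
  have hρ (π j i y) : ρ π (x (j, i) y) = x (j, π i) y := by
    rw [← galoisPerm_apply]
    have : galoisPerm k F L (ρ π) =
        x.permCongrHom (Equiv.prodCongr (Equiv.refl J) π) :=
      (MulEquiv.ofBijective _ h).apply_symm_apply _
    rw [this]
    simp [Equiv.permCongrHom]
  have hinj : Function.Injective ρ := by
    intro π π' hππ'
    obtain ⟨j⟩ := ‹Nonempty J›
    ext i
    have : x (j, π i) = x (j, π' i) := AlgHom.ext fun y ↦ by rw [← hρ, ← hρ, hππ']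
    simpa using this
  refine ⟨IntermediateField.fixedField ρ.range, (ρ.ofInjective hinj).trans <|
    (MulEquiv.subgroupCongr (IntermediateField.fixingSubgroup_fixedField ρ.range).symm).trans
      (IntermediateField.fixingSubgroupEquiv _), fun π j i y ↦ hρ π j i y⟩

end Diagonal

/-! ### Passage to a generic subextension -/

theorem lemma1 (r s : ℕ) (hr : 1 < r) (hs : 1 < s)
    (k F : Type u) [Field k] [Field F] [Algebra k F] [FiniteDimensional k F]
    (hF : IsGenericExtension k F (r * s))
    (hT : IsStablyRational (normTorusHom k F)) :
    ∃ (E : IntermediateField k (IntermediateField.normalClosure k F (AlgebraicClosure F)))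
      (K : IntermediateField E (IntermediateField.normalClosure k F (AlgebraicClosure F))),
      IsGenericExtension E K r ∧ IsStablyRational (normTorusHom E K) := by
  have := hF.isSeparable
  let L := IntermediateField.normalClosure k F (AlgebraicClosure F)
  have : IsGalois k L := isGalois_normalClosure_algebraicClosure k F
  obtain ⟨hsplits, htop⟩ :=
    Algebra.IsAlgebraic.isNormalClosure_iff.1 (isNormalClosure_algebraicClosure k F)
  have hcard : Nat.card (F →ₐ[k] L) = r * s := by
    rw [Nat.card_eq_fintype_card, AlgHom.card_of_splits k F L hsplits, hF.finrank_eq]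
  obtain ⟨φ⟩ := hF.gal_equiv
  have hbij := galoisPerm_bijective_of_equiv htop hcard φ
  -- `Option J` indexes the `s` rows, with `none` the row that becomes the norm torus factor
  let J := ULift.{u} (Fin (s - 1))
  have hJ : Nat.card (Option J) = s := by
    simp [J]
    omega
  have hI : Nat.card (Fin r) = r := Nat.card_fin r
  let x : Option J × Fin r ≃ (F →ₐ[k] L) :=
    (Finite.card_eq.1 (by rw [Nat.card_prod, hJ, hI, hcard, mul_comm])).some
  obtain ⟨E, γ, hγ⟩ := exists_diagonal_perm hbij x
  let i₀ : Fin r := ⟨0, by omega⟩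
  obtain ⟨e⟩ := exists_tensorProduct_equiv (fun j i ↦ x (j, i)) γ i₀ hγ x.injective
    (by rw [hF.finrank_eq, hJ, hI, mul_comm])
  refine ⟨E, letterField γ i₀, ?_, hT.of_splitting e⟩
  have := isGenericExtension_letterField (fun j i ↦ x (j, i)) γ i₀ hγ x.surjective htop
  rwa [hI] at this
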